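/- For a spectral measure $E$ on Borel subsets of $\mathbb R$ (a map from Borel sets to orthogonal projections on a complex Hilbert space $H$ with $E(\mathbb R)=I$, countably additive in the strong operator topology), let $L^\infty(E;\ell^2)$ be the set of sequences $\{\alpha_j\}_{j\ge0}$ of measurable functions with $\sum_j|\alpha_j(x)|^2\le C$ for some constant $C$ and $E$-almost every $x$, and let $L^\infty(E;\mathcal B)$ be the set of infinite matrices $\{\beta_{jk}\}_{j,k\ge0}$ of measurable functions such that, for some $C$ and $E$-almost every $x$, the matrix $\{\beta_{jk}(x)\}_{j,k\ge0}$ induces a bounded linear operator on $\ell^2$ of norm at most $C$. A function $\Psi$ on $\mathbb R^3$ belongs to the Haagerup tensor product $L^\infty(E_1)\otimes_{\rm h}L^\infty(E_2)\otimes_{\rm h}L^\infty(E_3)$ if it admits a representation $$\Psi(x_1,x_2,x_3)=\sum_{j,k\ge0}\alpha_j(x_1)\beta_{jk}(x_2)\gamma_k(x_3)\quad\text{almost everywhere with respect to } E_1, E_2, E_3,\qquad(*)$$ with $\{\alpha_j\}\in L^\infty(E_1;\ell^2)$, $\{\beta_{jk}\}\in L^\infty(E_2;\mathcal B)$, $\{\gamma_k\}\in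 L^\infty(E_3;\ell^2)$; here double series are limits of their rectangular partial sums, and "almost everywhere" refers to the product of the measures $\langle E_i(\cdot)u_i,u_i\rangle$, $i=1,2,3$, for all $u_1,u_2,u_3\in H$. For such $\Psi$ and bounded operators $T$, $R$ on $H$, the triple operator integral $\iiint\Psi\,dE_1\,T\,dE_2\,R\,dE_3$ is the bounded operator $$\sum_{j,k\ge0}\Big(\int\alpha_j\,dE_1\Big)T\Big(\int\beta_{jk}\,dE_2\Big)R\Big(\int\gamma_k\,dE_3\Big),$$ the double series converging in the weak operator topology, with the same sum for every representation $(*)$. Let $\boldsymbol S_1$ denote the trace class. **Theorem.** There are spectral measures $E_1$, $E_2$ and $E_3$ on Borel subsets of $\mathbb R$, acting on the Hilbert space $\ell^2$, a function $\Psi$ in the Haagerup tensor product $L^\infty(E_1)\otimes_{\rm h}L^\infty(E_2)\otimes_{\rm h}L^\infty(E_3)$, and an operator $Q\in\boldsymbol S_1$ such that the triple operator integral (with $T=I$ and $R=Q$) satisfies $$\iiint\Psi(x_1,x_2,x_3)\,dE_1(x_1)\,dE_2(x_2)\,Q\,dE_3(x_3)\notin\boldsymbol S_1 .$$ -/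

import Mathlib

open MeasureTheory Filter Topology
open scoped InnerProductSpace

/-- A spectral measure on the measurable space `X` acting on the Hilbert space `H`: a map sending
measurable sets to orthogonal projections, with `E X = I`, countably additive in the strong
operator topology.  (Its values on non-measurable sets are irrelevant.) -/
structure SpectralMeasure (X : Type*) [MeasurableSpace X] (H : Type*) [NormedAddCommGroup H]
    [InnerProductSpace ℂ H] [CompleteSpace H] where
  /-- the projection attached to a set -/
  proj : Set X → H →L[ℂ] H
  isStarProjection_proj : ∀ s, MeasurableSet s → IsStarProjection (proj s)
  proj_univ : proj Set.univ = 1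
  hasSum_proj_iUnion : ∀ s : ℕ → Set X, (∀ n, MeasurableSet (s n)) →
    Pairwise (Function.onFun Disjoint s) →
      ∀ u : H, HasSum (fun n => proj (s n) u) (proj (⋃ n, s n) u)

namespace SpectralMeasure

/-- An operator is bounded in norm by its quadratic form. -/
theorem norm_le_of_quadratic {H : Type*} [NormedAddCommGroup H] [InnerProductSpace ℂ H]
    (A : H →L[ℂ] H) {c : ℝ} (hc : 0 ≤ c)
    (h : ∀ u : H, ‖⟪u, A u⟫_ℂ‖ ≤ c * ‖u‖ ^ 2) : ‖A‖ ≤ 4 * c := by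
  refine A.opNorm_le_bound (by positivity) fun x => ?_
  rcases eq_or_ne (A x) 0 with hy | hy
  · rw [hy, norm_zero]; positivity
  have hy0 : 0 < ‖A x‖ := norm_pos_iff.2 hy
  have hx0 : 0 < ‖x‖ := norm_pos_iff.2 fun h0 => hy (by rw [h0, map_zero])
  set y : H := ((‖x‖ / ‖A x‖ : ℝ) : ℂ) • A x with hydef
  have hny : ‖y‖ = ‖x‖ := by
    rw [hydef, norm_smul, Complex.norm_real, Real.norm_of_nonneg (by positivity)]
    field_simp
  have hin : ‖⟪y, A x⟫_ℂ‖ = ‖x‖ * ‖A x‖ := by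
    rw [hydef, inner_smul_left, norm_mul, Complex.conj_ofReal, Complex.norm_real,
      Real.norm_of_nonneg (by positivity), inner_self_eq_norm_sq_to_K]
    simp
    field_simp
  have hq : ∀ z : H, ‖z‖ ≤ 2 * ‖x‖ → ‖⟪A z, z⟫_ℂ‖ ≤ 4 * c * ‖x‖ ^ 2 := fun z hz => by
    rw [← inner_conj_symm, RCLike.norm_conj]
    refine (h z).trans ?_
    have : ‖z‖ ^ 2 ≤ (2 * ‖x‖) ^ 2 := by gcongr
    nlinarith
  have hI : ‖Complex.I • y‖ = ‖x‖ := by rw [norm_smul, Complex.norm_I, one_mul, hny]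
  have hadd : ∀ z : H, ‖z‖ = ‖x‖ → ‖x + z‖ ≤ 2 * ‖x‖ := fun z hz =>
    (norm_add_le _ _).trans (by rw [hz]; linarith)
  have hsub : ∀ z : H, ‖z‖ = ‖x‖ → ‖x - z‖ ≤ 2 * ‖x‖ := fun z hz =>
    (norm_sub_le _ _).trans (by rw [hz]; linarith)
  have hpol := inner_map_polarization' (A : H →ₗ[ℂ] H) x y
  have h1 := hq _ (hadd y hny)
  have h2 := hq _ (hsub y hny)
  have h3 := hq _ (hadd _ hI)
  have h4 := hq _ (hsub _ hI)
  have hmain : ‖⟪A x, y⟫_ℂ‖ ≤ 4 * c * ‖x‖ ^ 2 := by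
    simp only [ContinuousLinearMap.coe_coe] at hpol
    rw [hpol, norm_div]
    have e4 : ‖(4 : ℂ)‖ = 4 := by simp
    rw [e4, div_le_iff₀ (by norm_num)]
    refine (norm_add_le _ _).trans ?_
    refine (add_le_add_left (norm_sub_le _ _) _).trans ?_
    refine (add_le_add_left (add_le_add_left (norm_sub_le _ _) _) _).trans ?_
    simp only [norm_mul, Complex.norm_I, one_mul]
    linarith
  rw [← inner_conj_symm, RCLike.norm_conj, hin] at hmain
  have : ‖x‖ * ‖A x‖ ≤ ‖x‖ * (4 * c * ‖x‖) := by nlinarith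
  exact le_of_mul_le_mul_left this hx0

section Integral

variable {X : Type*} [MeasurableSpace X] {H : Type*} [NormedAddCommGroup H]
  [InnerProductSpace ℂ H] [CompleteSpace H]

theorem proj_empty (E : SpectralMeasure X H) : E.proj ∅ = 0 := by
  ext u
  have h := E.hasSum_proj_iUnion (fun _ => ∅) (fun _ => MeasurableSet.empty)
    (fun _ _ _ => disjoint_bot_left) u
  simpa using tendsto_nhds_unique tendsto_const_nhds h.summable.tendsto_atTop_zero

theorem inner_proj_self (E : SpectralMeasure X H) {s : Set X} (hs : MeasurableSet s) (u : H) :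
    ⟪u, E.proj s u⟫_ℂ = ((‖E.proj s u‖ ^ 2 : ℝ) : ℂ) := by
  have h := E.isStarProjection_proj s hs
  have h1 : E.proj s (E.proj s u) = E.proj s u :=
    congrArg (fun A : H →L[ℂ] H => A u) h.isIdempotentElem.eq
  have h2 : ContinuousLinearMap.adjoint (E.proj s) = E.proj s := h.isSelfAdjoint
  calc ⟪u, E.proj s u⟫_ℂ = ⟪u, ContinuousLinearMap.adjoint (E.proj s) (E.proj s u)⟫_ℂ := by
        rw [h2, h1]
    _ = ⟪E.proj s u, E.proj s u⟫_ℂ := by rw [ContinuousLinearMap.adjoint_inner_right]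
    _ = _ := by rw [inner_self_eq_norm_sq_to_K]; norm_cast

/-- The scalar measure `μ_u(s) = ⟨E(s)u, u⟩` attached to a vector `u`. -/
noncomputable def scalarMeasure (E : SpectralMeasure X H) (u : H) : Measure X :=
  Measure.ofMeasurable (fun s _ => ENNReal.ofReal (⟪u, E.proj s u⟫_ℂ).re)
    (by simp [E.proj_empty])
    (by
      intro s hs hd
      have h := (E.hasSum_proj_iUnion s hs hd u).mapL (innerSL ℂ u)
      have h' := h.mapL Complex.reCLM
      simp only [innerSL_apply_apply, Complex.reCLM_apply] at h'
      have hnn : ∀ n, 0 ≤ (⟪u, E.proj (s n) u⟫_ℂ).re := fun n => by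
        rw [E.inner_proj_self (hs n), Complex.ofReal_re]; positivity
      change ENNReal.ofReal (⟪u, E.proj (⋃ n, s n) u⟫_ℂ).re = _
      rw [← h'.tsum_eq, ENNReal.ofReal_tsum_of_nonneg hnn h'.summable])

theorem scalarMeasure_apply (E : SpectralMeasure X H) (u : H) {s : Set X}
    (hs : MeasurableSet s) : E.scalarMeasure u s = ENNReal.ofReal (⟪u, E.proj s u⟫_ℂ).re :=
  Measure.ofMeasurable_apply s hs

instance isFiniteMeasure_scalarMeasure (E : SpectralMeasure X H) (u : H) :
    IsFiniteMeasure (E.scalarMeasure u) :=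
  ⟨by rw [E.scalarMeasure_apply u MeasurableSet.univ]; exact ENNReal.ofReal_lt_top⟩

theorem coe_scalarMeasure_real (E : SpectralMeasure X H) (u : H) {s : Set X}
    (hs : MeasurableSet s) : ((E.scalarMeasure u).real s : ℂ) = ⟪u, E.proj s u⟫_ℂ := by
  rw [Measure.real, E.scalarMeasure_apply u hs, E.inner_proj_self hs, Complex.ofReal_re,
    ENNReal.toReal_ofReal (by positivity)]

theorem scalarMeasure_real_univ (E : SpectralMeasure X H) (u : H) :
    (E.scalarMeasure u).real Set.univ = ‖u‖ ^ 2 := by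
  have h := E.coe_scalarMeasure_real u MeasurableSet.univ
  rw [E.inner_proj_self MeasurableSet.univ, E.proj_univ] at h
  simpa using Complex.ofReal_injective h

/-- A property holds `E`-almost everywhere if it holds almost everywhere for each of the scalar
measures `⟨E(·)u, u⟩`; thus a measurable set `N` is `E`-null if and only if `E(N) = 0`. -/
def AE (E : SpectralMeasure X H) (p : X → Prop) : Prop :=
  ∀ u : H, ∀ᵐ x ∂E.scalarMeasure u, p x

/-- `A = ∫ f dE`, in the sense that `⟨A u, u⟩ = ∫ f(x) d⟨E(x)u, u⟩` for all `u`. -/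
def HasIntegral (E : SpectralMeasure X H) (f : X → ℂ) (A : H →L[ℂ] H) : Prop :=
  ∀ u : H, ⟪u, A u⟫_ℂ = ∫ x, f x ∂E.scalarMeasure u

theorem HasIntegral.unique {E : SpectralMeasure X H} {f : X → ℂ} {A B : H →L[ℂ] H}
    (hA : E.HasIntegral f A) (hB : E.HasIntegral f B) : A = B := by
  have h : (A : H →ₗ[ℂ] H) = (B : H →ₗ[ℂ] H) := by
    rw [← ext_inner_map]
    intro u
    rw [← inner_conj_symm, ← inner_conj_symm (B.toLinearMap u)]
    exact congrArg _ ((hA u).trans (hB u).symm)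
  exact ContinuousLinearMap.coe_injective h

theorem integrable_of_ae_bound (E : SpectralMeasure X H) {f : X → ℂ} (hf : Measurable f) {C : ℝ}
    (hC : E.AE fun x => ‖f x‖ ≤ C) (u : H) : Integrable f (E.scalarMeasure u) :=
  Integrable.of_bound hf.aestronglyMeasurable C (hC u)

theorem exists_hasIntegral_simpleFunc (E : SpectralMeasure X H) (g : SimpleFunc X ℂ) :
    ∃ A, E.HasIntegral g A := by
  refine ⟨∑ c ∈ g.range, c • E.proj (g ⁻¹' {c}), fun u => ?_⟩
  obtain ⟨C, hC⟩ := g.exists_forall_norm_le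
  rw [SimpleFunc.integral_eq_sum _
    (E.integrable_of_ae_bound g.measurable (fun u => Eventually.of_forall hC) u)]
  rw [_root_.sum_apply, inner_sum]
  refine Finset.sum_congr rfl fun c _ => ?_
  rw [_root_.smul_apply, inner_smul_right,
    ← E.coe_scalarMeasure_real u (g.measurableSet_fiber c), Complex.real_smul, mul_comm]

theorem exists_simpleFunc_near {f : X → ℂ} (hf : Measurable f) {C : ℝ} (hC : ∀ x, ‖f x‖ ≤ C)
    {ε : ℝ} (hε : 0 < ε) : ∃ g : SimpleFunc X ℂ, ∀ x, ‖g x - f x‖ ≤ ε := by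
  have hcov : Metric.closedBall (0 : ℂ) C ⊆
      ⋃ n, Metric.ball (TopologicalSpace.denseSeq ℂ n) ε := fun z _ => by
    obtain ⟨n, hn⟩ :=
      (TopologicalSpace.denseRange_denseSeq ℂ).exists_dist_lt z hε
    exact Set.mem_iUnion.2 ⟨n, hn⟩
  obtain ⟨t, ht⟩ := (isCompact_closedBall (0 : ℂ) C).elim_finite_subcover _
    (fun _ => Metric.isOpen_ball) hcov
  refine ⟨(SimpleFunc.nearestPt (TopologicalSpace.denseSeq ℂ) (t.sup id)).comp f hf, fun x => ?_⟩
  have hx := ht (show f x ∈ Metric.closedBall (0 : ℂ) C by simpa using hC x)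
  simp only [Set.mem_iUnion] at hx
  obtain ⟨n, hn, hx⟩ := hx
  have h1 := SimpleFunc.edist_nearestPt_le (TopologicalSpace.denseSeq ℂ) (f x)
    (Finset.le_sup (f := id) hn)
  rw [SimpleFunc.coe_comp, Function.comp_apply, ← dist_eq_norm]
  rw [id, edist_dist, edist_dist, ENNReal.ofReal_le_ofReal_iff dist_nonneg] at h1
  rw [Metric.mem_ball, dist_comm] at hx
  exact h1.trans hx.le

/-- Every measurable `E`-essentially bounded function has an integral with respect to `E`. -/
theorem exists_hasIntegral (E : SpectralMeasure X H) {f : X → ℂ} (hf : Measurable f) {C : ℝ}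
    (hC : E.AE fun x => ‖f x‖ ≤ C) : ∃ A, E.HasIntegral f A := by
  classical
  have hS : MeasurableSet {x | ‖f x‖ ≤ C} := measurableSet_le hf.norm measurable_const
  set f' : X → ℂ := Set.indicator {x | ‖f x‖ ≤ C} f with hf'
  have hf'm : Measurable f' := hf.indicator hS
  have hf'C : ∀ x, ‖f' x‖ ≤ max C 0 := fun x => by
    by_cases hx : x ∈ {x | ‖f x‖ ≤ C}
    · rw [hf', Set.indicator_of_mem hx]; exact le_max_of_le_left hx
    · rw [hf', Set.indicator_of_notMem hx, norm_zero]; exact le_max_right _ _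
  have hae : ∀ u, f' =ᵐ[E.scalarMeasure u] f := fun u => by
    filter_upwards [hC u] with x hx
    exact Set.indicator_of_mem (show x ∈ {x | ‖f x‖ ≤ C} from hx) f
  suffices h : ∃ A, E.HasIntegral f' A by
    obtain ⟨A, hA⟩ := h
    exact ⟨A, fun u => (hA u).trans (integral_congr_ae (hae u))⟩
  choose g hg using fun n : ℕ =>
    exists_simpleFunc_near hf'm hf'C (Nat.one_div_pos_of_nat (α := ℝ) (n := n))
  choose A hA using fun n => E.exists_hasIntegral_simpleFunc (g n)
  have hgi : ∀ n u, Integrable (g n) (E.scalarMeasure u) := fun n u => by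
    obtain ⟨C', hC'⟩ := (g n).exists_forall_norm_le
    exact E.integrable_of_ae_bound (g n).measurable (fun u => Eventually.of_forall hC') u
  have hfi : ∀ u, Integrable f' (E.scalarMeasure u) := fun u =>
    E.integrable_of_ae_bound hf'm (fun u => Eventually.of_forall hf'C) u
  have hcau : CauchySeq A := by
    refine cauchySeq_of_le_tendsto_0 (fun n : ℕ => 8 * (1 / ((n : ℝ) + 1))) ?_
      (by simpa using (tendsto_one_div_add_atTop_nhds_zero_nat (𝕜 := ℝ)).const_mul 8)
    intro n m N hn hm
    rw [dist_eq_norm]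
    have hle : ∀ k : ℕ, N ≤ k → (1 / ((k : ℝ) + 1)) ≤ 1 / ((N : ℝ) + 1) := fun k hk =>
      one_div_le_one_div_of_le (by positivity) (by exact_mod_cast Nat.succ_le_succ hk)
    refine (norm_le_of_quadratic _ (c := 2 * (1 / ((N : ℝ) + 1))) (by positivity) ?_).trans
      (by linarith)
    intro u
    rw [_root_.sub_apply, inner_sub_right, hA n u, hA m u,
      ← integral_sub (hgi n u) (hgi m u), ← E.scalarMeasure_real_univ u]
    refine norm_integral_le_of_norm_le_const (Eventually.of_forall fun x => ?_)
    calc ‖g n x - g m x‖ = ‖(g n x - f' x) - (g m x - f' x)‖ := by rw [sub_sub_sub_cancel_right]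
      _ ≤ ‖g n x - f' x‖ + ‖g m x - f' x‖ := norm_sub_le _ _
      _ ≤ 2 * (1 / ((N : ℝ) + 1)) := by
        linarith [hg n x, hg m x, hle n hn, hle m hm]
  obtain ⟨B, hB⟩ := cauchySeq_tendsto_of_complete hcau
  refine ⟨B, fun u => ?_⟩
  have h1 : Tendsto (fun n => ⟪u, A n u⟫_ℂ) atTop (𝓝 ⟪u, B u⟫_ℂ) :=
    tendsto_const_nhds.inner ((ContinuousLinearMap.apply ℂ H u).continuous.tendsto B |>.comp hB)
  refine tendsto_nhds_unique h1 ?_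
  simp only [hA _ u]
  rw [tendsto_iff_norm_sub_tendsto_zero]
  refine squeeze_zero (fun _ => norm_nonneg _) (fun n => ?_)
    (by simpa using (tendsto_one_div_add_atTop_nhds_zero_nat (𝕜 := ℝ)).mul_const (‖u‖ ^ 2))
  rw [← integral_sub (hgi n u) (hfi u), ← E.scalarMeasure_real_univ u]
  exact norm_integral_le_of_norm_le_const
    (Eventually.of_forall fun x => (hg n x).trans (by simp))

open Classical in
/-- The spectral integral `∫ f dE`, the bounded operator `A` with
`⟨A u, u⟩ = ∫ f(x) d⟨E(x)u, u⟩` for all `u`.  It exists and is unique for every measurable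
`E`-essentially bounded `f`, see `hasIntegral_integral`. -/
noncomputable def integral (E : SpectralMeasure X H) (f : X → ℂ) : H →L[ℂ] H :=
  if h : ∃ A, E.HasIntegral f A then h.choose else 0

theorem hasIntegral_integral (E : SpectralMeasure X H) {f : X → ℂ} (hf : Measurable f) {C : ℝ}
    (hC : E.AE fun x => ‖f x‖ ≤ C) : E.HasIntegral f (E.integral f) := by
  have h := E.exists_hasIntegral hf hC
  rw [integral, dif_pos h]
  exact h.choose_spec

/-- `{α_j} ∈ L^∞(E; ℓ²)`. -/
def MemLinftyEll2 (E : SpectralMeasure X H) (α : ℕ → X → ℂ) : Prop :=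
  (∀ j, Measurable (α j)) ∧
    ∃ C : ℝ, E.AE fun x => Summable (fun j => ‖α j x‖ ^ 2) ∧ ∑' j, ‖α j x‖ ^ 2 ≤ C

/-- `{β_jk} ∈ L^∞(E; 𝓑)`, where `𝓑` is the space of infinite matrices `b` that induce bounded
operators on `ℓ²`: there is a bounded `B` on `ℓ²` with `(B e_k)_j = b_jk`, and the norm of `b`
is `‖B‖`. -/
def MemLinftyMatrix (E : SpectralMeasure X H) (β : ℕ → ℕ → X → ℂ) : Prop :=
  (∀ j k, Measurable (β j k)) ∧
    ∃ C : ℝ, E.AE fun x =>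
      ∃ B : lp (fun _ : ℕ => ℂ) 2 →L[ℂ] lp (fun _ : ℕ => ℂ) 2,
        ‖B‖ ≤ C ∧ ∀ j k, (B (lp.single 2 k (1 : ℂ)) : ℕ → ℂ) j = β j k x

end Integral

section Triple

variable {X₁ X₂ X₃ : Type*} [MeasurableSpace X₁] [MeasurableSpace X₂] [MeasurableSpace X₃]
  {H : Type*} [NormedAddCommGroup H] [InnerProductSpace ℂ H] [CompleteSpace H]

/-- A Haagerup representation `Ψ(x₁,x₂,x₃) = ∑_{j,k} α_j(x₁) β_jk(x₂) γ_k(x₃)` with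
`α, γ ∈ L^∞(ℓ²)` and `β ∈ L^∞(𝓑)`.  The double series is the limit of its rectangular partial
sums, and the equality holds almost everywhere with respect to the product of `E₁, E₂, E₃`
(that is, of all their scalar measures). -/
def IsHaagerupRepresentation (E₁ : SpectralMeasure X₁ H) (E₂ : SpectralMeasure X₂ H)
    (E₃ : SpectralMeasure X₃ H) (Ψ : X₁ → X₂ → X₃ → ℂ)
    (α : ℕ → X₁ → ℂ) (β : ℕ → ℕ → X₂ → ℂ) (γ : ℕ → X₃ → ℂ) : Prop :=
  E₁.MemLinftyEll2 α ∧ E₂.MemLinftyMatrix β ∧ E₃.MemLinftyEll2 γ ∧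
    ∀ u₁ u₂ u₃ : H,
      ∀ᵐ x ∂((E₁.scalarMeasure u₁).prod ((E₂.scalarMeasure u₂).prod (E₃.scalarMeasure u₃))),
        Tendsto (fun p : ℕ × ℕ => ∑ j ∈ Finset.range p.1, ∑ k ∈ Finset.range p.2,
          α j x.1 * β j k x.2.1 * γ k x.2.2) atTop (𝓝 (Ψ x.1 x.2.1 x.2.2))

/-- `Ψ ∈ L^∞(E₁) ⊗_h L^∞(E₂) ⊗_h L^∞(E₃)`. -/
def MemHaagerup (E₁ : SpectralMeasure X₁ H) (E₂ : SpectralMeasure X₂ H)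
    (E₃ : SpectralMeasure X₃ H) (Ψ : X₁ → X₂ → X₃ → ℂ) : Prop :=
  ∃ α β γ, IsHaagerupRepresentation E₁ E₂ E₃ Ψ α β γ

/-- `W = ∭ Ψ(x₁,x₂,x₃) dE₁(x₁) T dE₂(x₂) R dE₃(x₃)` for `Ψ` in the Haagerup tensor product:
for every Haagerup representation of `Ψ`, the series
`∑_{j,k} (∫ α_j dE₁) T (∫ β_jk dE₂) R (∫ γ_k dE₃)` converges to `W` in the weak operator
topology. -/
def IsTripleOperatorIntegral (E₁ : SpectralMeasure X₁ H) (E₂ : SpectralMeasure X₂ H)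
    (E₃ : SpectralMeasure X₃ H) (Ψ : X₁ → X₂ → X₃ → ℂ) (T R W : H →L[ℂ] H) : Prop :=
  MemHaagerup E₁ E₂ E₃ Ψ ∧
    ∀ α β γ, IsHaagerupRepresentation E₁ E₂ E₃ Ψ α β γ →
      ∀ u v : H, Tendsto (fun p : ℕ × ℕ =>
        ⟪v, (∑ j ∈ Finset.range p.1, ∑ k ∈ Finset.range p.2,
          E₁.integral (α j) * T * E₂.integral (β j k) * R * E₃.integral (γ k)) u⟫_ℂ)
        atTop (𝓝 ⟪v, W u⟫_ℂ)

end Triple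

end SpectralMeasure

/-- `T` is of trace class, `T ∈ S₁`: the trace `∑_i ⟨|T| b_i, b_i⟩` of `|T| = (T* T)^{1/2}` is
finite in every orthonormal basis (its value does not depend on the basis). -/
def IsTraceClass {H : Type*} [NormedAddCommGroup H] [InnerProductSpace ℂ H] [CompleteSpace H]
    (T : H →L[ℂ] H) : Prop :=
  ∀ (s : Set H) (b : HilbertBasis s ℂ H),
    Summable fun i => (⟪b i, CFC.abs T (b i)⟫_ℂ).re

/-!
The three spectral measures are purely atomic: `E₁ = E₃` is diagonal in a Hilbert basis `b`, and
`E₂` is diagonal in another Hilbert basis `f`.  The symbol is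
`Ψ(x₁, x₂, x₃) = δ(x₁, x₃) φ(x₁, x₂)` with `|φ| ≤ 1`; it has the representation `α_j = γ_j = δ_j`,
`β_jk(x₂) = δ_jk φ(j, x₂)`, whose middle matrix is a diagonal contraction for each `x₂`.  For the
rank one operator `Q = ⟪w, ·⟫ v`, the triple operator integral is the diagonal operator in the
basis `b` with entries `⟪w, b i⟫ * ∑ x, φ(i, x) ⟪b i, f x⟫ ⟪f x, v⟫`.  Choosing for `φ` the conjugate
phases, these entries become `⟪w, b i⟫ * ∑ x, |⟪b i, f x⟫ ⟪f x, v⟫|`.  They fail to be summable for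
suitable `v` and `w` as soon as the matrix `|⟪b i, f x⟫|` is unbounded on `ℓ²`, which happens when
the change of basis is a direct sum of Fourier matrices of `ℤ/N` with `N → ∞`: a unitary `N × N`
matrix whose entries all have modulus `N ^ (-1/2)` acquires the norm `N ^ (1/2)` when its entries are
replaced by their absolute values.

That the operator so obtained is the sum of the series for every representation of `Ψ` is
`SpectralMeasure.isTripleOperatorIntegral_atomic`.  The partial sums are uniformly bounded
(`norm_sum_diagonal_mul_le`, by the Cauchy-Schwarz type bound that is built into the Haagerup tensor
product), so it is enough to compute the limit of their matrix entries
(`tendsto_inner_of_tendsto_inner_basis`); such an entry is an absolutely convergent series over the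
atoms of `E₂`, to which dominated convergence applies.
-/

/-! ### Diagonal operators in a Hilbert basis -/

section Diagonal

variable {ι H : Type*} [NormedAddCommGroup H] [InnerProductSpace ℂ H]

open Classical in
/-- The diagonal operator `u ↦ ∑ i, h i * ⟪b i, u⟫ • b i` in the Hilbert basis `b`.  It is `0` by
convention when `h` is unbounded. -/
noncomputable def HilbertBasis.diagonal (b : HilbertBasis ι ℂ H) (h : ι → ℂ) : H →L[ℂ] H :=
  if hh : ∃ C, ∀ i, ‖h i‖ ≤ C then
    have key : ∀ a : lp (fun _ : ι => ℂ) 2, Memℓp (fun i => h i * a i) 2 := fun a => by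
      obtain ⟨C, hC⟩ := hh
      refine memℓp_gen (Summable.of_nonneg_of_le (fun _ => by positivity) (fun i => ?_)
        (((lp.memℓp a).summable (by norm_num)).mul_left (C ^ 2)))
      simp only [ENNReal.toReal_ofNat, Real.rpow_ofNat, norm_mul, mul_pow]
      have := hC i
      gcongr
    LinearMap.mkContinuousOfExistsBound
      { toFun := fun u => b.repr.symm ⟨fun i => h i * b.repr u i, key _⟩
        map_add' := fun u v => by
          rw [← map_add]
          congr 1
          ext i
          simp [mul_add]
          rfl
        map_smul' := fun c u => by
          rw [RingHom.id_apply, ← map_smul]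
          congr 1
          ext i
          simp [mul_left_comm] }
      (by
        obtain ⟨C, hC⟩ := hh
        refine ⟨|C|, fun u => ?_⟩
        simp only [LinearMap.coe_mk, AddHom.coe_mk, LinearIsometryEquiv.norm_map]
        refine lp.norm_le_of_forall_sum_le (p := 2) (by norm_num) (by positivity) fun s => ?_
        calc _ ≤ ∑ i ∈ s, |C| ^ 2 * ‖b.repr u i‖ ^ (2 : ENNReal).toReal := by
              refine Finset.sum_le_sum fun i _ => ?_
              simp only [ENNReal.toReal_ofNat, Real.rpow_ofNat, norm_mul, mul_pow]
              have := (hC i).trans (le_abs_self C)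
              gcongr
          _ ≤ |C| ^ 2 * ‖b.repr u‖ ^ (2 : ENNReal).toReal := by
              rw [← Finset.mul_sum]
              gcongr
              exact lp.sum_rpow_le_norm_rpow (by norm_num) _ s
          _ = _ := by
              simp [mul_pow])
  else 0

namespace HilbertBasis

variable (b : HilbertBasis ι ℂ H)

theorem ext_inner {x y : H} (h : ∀ i, ⟪b i, x⟫_ℂ = ⟪b i, y⟫_ℂ) : x = y := by
  refine b.repr.injective (lp.ext (funext fun i => ?_))
  rw [b.repr_apply_apply, b.repr_apply_apply, h]

theorem inner_diagonal {h : ι → ℂ} {C : ℝ} (hh : ∀ i, ‖h i‖ ≤ C) (i : ι) (u : H) :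
    ⟪b i, b.diagonal h u⟫_ℂ = h i * ⟪b i, u⟫_ℂ := by
  rw [diagonal, dif_pos ⟨C, hh⟩, ← b.repr_apply_apply, ← b.repr_apply_apply]
  simp

theorem inner_basis [DecidableEq ι] (i j : ι) : ⟪b i, b j⟫_ℂ = if i = j then 1 else 0 :=
  orthonormal_iff_ite.1 b.orthonormal i j

theorem diagonal_apply_self {h : ι → ℂ} {C : ℝ} (hh : ∀ i, ‖h i‖ ≤ C) (i : ι) :
    b.diagonal h (b i) = h i • b i := by
  classical
  refine b.ext_inner fun j => ?_
  rw [b.inner_diagonal hh, inner_smul_right, b.inner_basis]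
  split_ifs with hij
  · rw [hij]
  · simp

theorem adjoint_diagonal [CompleteSpace H] {h : ι → ℂ} {C : ℝ} (hh : ∀ i, ‖h i‖ ≤ C) :
    ContinuousLinearMap.adjoint (b.diagonal h) = b.diagonal fun i => star (h i) := by
  ext u
  refine b.ext_inner fun i => ?_
  rw [b.inner_diagonal (C := C) (by simpa using hh), ContinuousLinearMap.adjoint_inner_right,
    b.diagonal_apply_self hh, inner_smul_left]
  rfl

theorem hasSum_inner_diagonal {h : ι → ℂ} {C : ℝ} (hh : ∀ i, ‖h i‖ ≤ C) (u v : H) :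
    HasSum (fun i => h i * (⟪u, b i⟫_ℂ * ⟪b i, v⟫_ℂ)) ⟪u, b.diagonal h v⟫_ℂ := by
  refine (b.hasSum_inner_mul_inner u (b.diagonal h v)).congr_fun fun i => ?_
  rw [b.inner_diagonal hh]
  ring

theorem hasSum_norm_inner_sq (u : H) : HasSum (fun i => ‖⟪b i, u⟫_ℂ‖ ^ 2) (‖u‖ ^ 2) := by
  have h := (b.hasSum_inner_mul_inner u u).mapL Complex.reCLM
  convert h using 2 with i
  · rw [Complex.reCLM_apply, ← inner_conj_symm u, ← Complex.normSq_eq_conj_mul_self,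
      Complex.ofReal_re, Complex.normSq_eq_norm_sq]
  · rw [Complex.reCLM_apply, inner_self_eq_norm_sq_to_K]
    norm_cast

theorem hasSum_inner_diagonal_self {h : ι → ℂ} {C : ℝ} (hh : ∀ i, ‖h i‖ ≤ C) (u : H) :
    HasSum (fun i => h i * (‖⟪b i, u⟫_ℂ‖ ^ 2 : ℝ)) ⟪u, b.diagonal h u⟫_ℂ := by
  refine (b.hasSum_inner_diagonal hh u u).congr_fun fun i => ?_
  rw [← inner_conj_symm u, ← Complex.normSq_eq_conj_mul_self, Complex.normSq_eq_norm_sq]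

theorem hasSum_norm_inner_diagonal_sq {h : ι → ℂ} {C : ℝ} (hh : ∀ i, ‖h i‖ ≤ C) (u : H) :
    HasSum (fun i => ‖h i‖ ^ 2 * ‖⟪b i, u⟫_ℂ‖ ^ 2) (‖b.diagonal h u‖ ^ 2) := by
  refine (b.hasSum_norm_inner_sq (b.diagonal h u)).congr_fun fun i => ?_
  rw [b.inner_diagonal hh, norm_mul, mul_pow]

theorem norm_diagonal_le {h : ι → ℂ} {C : ℝ} (hC : 0 ≤ C) (hh : ∀ i, ‖h i‖ ≤ C) :
    ‖b.diagonal h‖ ≤ C := by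
  refine ContinuousLinearMap.opNorm_le_bound _ hC fun u => ?_
  refine le_of_sq_le_sq ?_ (by positivity)
  rw [mul_pow]
  refine hasSum_le (fun i => ?_) (b.hasSum_norm_inner_diagonal_sq hh u)
    ((b.hasSum_norm_inner_sq u).mul_left (C ^ 2))
  have := hh i
  gcongr

theorem exists_comp_equiv {ι' : Type*} [CompleteSpace H] (e : ι' ≃ ι) :
    ∃ b' : HilbertBasis ι' ℂ H, ⇑b' = b ∘ e := by
  refine ⟨HilbertBasis.mk (b.orthonormal.comp e e.injective) ?_, HilbertBasis.coe_mk _ _⟩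
  rw [EquivLike.range_comp, b.dense_span]

theorem _root_.norm_indicator_one_le (s : Set ι) (i : ι) : ‖s.indicator (1 : ι → ℂ) i‖ ≤ 1 := by
  by_cases h : i ∈ s <;> simp [h]

theorem hasSum_diagonal_indicator (s : Set ι) (u : H) :
    HasSum (fun i : s => ⟪b i, u⟫_ℂ • b i) (b.diagonal (s.indicator 1) u) := by
  classical
  refine (hasSum_subtype_iff_indicator (f := fun i => ⟪b i, u⟫_ℂ • b i)).2 ?_
  refine (b.hasSum_repr (b.diagonal (s.indicator 1) u)).congr_fun fun i => ?_
  rw [b.repr_apply_apply, b.inner_diagonal (norm_indicator_one_le s)]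
  by_cases h : i ∈ s <;> simp [h]

end HilbertBasis

end Diagonal

/-! ### Atomic spectral measures -/

namespace SpectralMeasure

section Atomic

variable {ι X H : Type*} [MeasurableSpace X] [NormedAddCommGroup H] [InnerProductSpace ℂ H]
  [CompleteSpace H]

/-- The purely atomic spectral measure with an atom at each point `g i`: the projection attached to
`s` is the orthogonal projection onto the closed span of the `b i` with `g i ∈ s`. -/
noncomputable def atomic (b : HilbertBasis ι ℂ H) (g : ι → X) : SpectralMeasure X H where
  proj s := b.diagonal ((g ⁻¹' s).indicator 1)
  isStarProjection_proj s _ := by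
    refine ⟨?_, ?_⟩
    · ext u
      refine b.ext_inner fun i => ?_
      rw [_root_.mul_apply_eq_comp, b.inner_diagonal (norm_indicator_one_le _),
        b.inner_diagonal (norm_indicator_one_le _)]
      by_cases h : i ∈ g ⁻¹' s <;> simp [h]
    · rw [IsSelfAdjoint, ContinuousLinearMap.star_eq_adjoint,
        b.adjoint_diagonal (norm_indicator_one_le _)]
      congr 1
      ext i
      by_cases h : i ∈ g ⁻¹' s <;> simp [h]
  proj_univ := by
    ext u
    refine b.ext_inner fun i => ?_
    rw [b.inner_diagonal (norm_indicator_one_le _)]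
    simp
  hasSum_proj_iUnion s _ hd u := by
    have hd' : Pairwise (Function.onFun Disjoint fun n => g ⁻¹' s n) := fun m n hmn =>
      (hd hmn).preimage g
    have h := b.hasSum_diagonal_indicator (⋃ n, g ⁻¹' s n) u
    rw [← (Set.unionEqSigmaOfDisjoint hd').symm.hasSum_iff] at h
    rw [Set.preimage_iUnion]
    exact h.sigma fun n => b.hasSum_diagonal_indicator (g ⁻¹' s n) u

theorem scalarMeasure_atomic (b : HilbertBasis ι ℂ H) (g : ι → X) (u : H) :
    (atomic b g).scalarMeasure u =
      Measure.sum fun i => ENNReal.ofReal (‖⟪b i, u⟫_ℂ‖ ^ 2) • Measure.dirac (g i) := by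
  ext s hs
  rw [scalarMeasure_apply _ _ hs, Measure.sum_apply _ hs]
  have h := (b.hasSum_inner_diagonal_self (norm_indicator_one_le (g ⁻¹' s)) u).mapL Complex.reCLM
  have h' : HasSum (fun i => (g ⁻¹' s).indicator (fun i => ‖⟪b i, u⟫_ℂ‖ ^ 2) i)
      (⟪u, (atomic b g).proj s u⟫_ℂ).re := by
    refine h.congr_fun fun i => ?_
    rw [Complex.reCLM_apply]
    by_cases hi : i ∈ g ⁻¹' s
    · rw [Set.indicator_of_mem hi, Set.indicator_of_mem hi, Pi.one_apply, one_mul,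
        Complex.ofReal_re]
    · simp [Set.indicator_of_notMem hi]
  rw [← h'.tsum_eq, ENNReal.ofReal_tsum_of_nonneg
    (fun i => Set.indicator_nonneg (fun _ _ => by positivity) i) h'.summable]
  refine tsum_congr fun i => ?_
  rw [Measure.smul_apply, Measure.dirac_apply' _ hs]
  by_cases hi : g i ∈ s <;> simp [hi]

theorem scalarMeasure_atomic_basis (b : HilbertBasis ι ℂ H) (g : ι → X) (i : ι) :
    (atomic b g).scalarMeasure (b i) = Measure.dirac (g i) := by
  classical
  ext s hs
  rw [scalarMeasure_atomic, Measure.sum_apply _ hs, tsum_eq_single i]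
  · rw [b.inner_basis, if_pos rfl]
    simp
  · intro j hj
    simp [b.inner_basis, hj]

theorem ae_atomic_iff [Countable ι] [MeasurableSingletonClass X] (b : HilbertBasis ι ℂ H)
    (g : ι → X) {p : X → Prop} : (atomic b g).AE p ↔ ∀ i, p (g i) := by
  refine ⟨fun h i => ?_, fun h u => ?_⟩
  · have := h (b i)
    rwa [scalarMeasure_atomic_basis, ae_dirac_eq] at this
  · rw [scalarMeasure_atomic, Measure.ae_sum_iff]
    intro i
    refine Measure.ae_smul_measure ?_ _
    rw [ae_dirac_eq]
    exact h i

/-- For an atomic spectral measure, `∫ f dE` is the diagonal operator with entries `f (g i)`. -/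
theorem integral_atomic [Countable ι] [MeasurableSingletonClass X] (b : HilbertBasis ι ℂ H)
    (g : ι → X) {f : X → ℂ} (hf : Measurable f) {C : ℝ} (hC : ∀ i, ‖f (g i)‖ ≤ C) :
    (atomic b g).integral f = b.diagonal fun i => f (g i) := by
  have hae : (atomic b g).AE fun x => ‖f x‖ ≤ C := (ae_atomic_iff b g).2 hC
  refine (hasIntegral_integral _ hf hae).unique fun u => ?_
  have hi := integrable_of_ae_bound _ hf hae u
  rw [scalarMeasure_atomic] at hi ⊢
  refine (b.hasSum_inner_diagonal_self hC u).unique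
    ((hasSum_integral_measure hi).congr_fun fun i => ?_)
  rw [integral_smul_measure, integral_dirac, ENNReal.toReal_ofReal (by positivity),
    Complex.real_smul, mul_comm]

end Atomic

end SpectralMeasure

/-! ### Weak convergence of uniformly bounded operators -/

/-- The sesquilinear form of a bounded matrix on finitely supported sequences.  The crude constant
comes from `2 * s * t ≤ s ^ 2 + t ^ 2`. -/
theorem norm_sum_range_matrix_le {b : ℕ → ℕ → ℂ}
    {B : lp (fun _ : ℕ => ℂ) 2 →L[ℂ] lp (fun _ : ℕ => ℂ) 2}
    (hB : ∀ j k, (B (lp.single 2 k (1 : ℂ)) : ℕ → ℂ) j = b j k) {C : ℝ} (hC : ‖B‖ ≤ C)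
    (a c : ℕ → ℂ) (m n : ℕ) :
    ‖∑ j ∈ Finset.range m, ∑ k ∈ Finset.range n, a j * b j k * c k‖ ≤
      C * (∑ j ∈ Finset.range m, ‖a j‖ ^ 2 + ∑ k ∈ Finset.range n, ‖c k‖ ^ 2) := by
  set x : lp (fun _ : ℕ => ℂ) 2 := ∑ k ∈ Finset.range n, c k • lp.single 2 k (1 : ℂ) with hx
  set y : lp (fun _ : ℕ => ℂ) 2 := ∑ j ∈ Finset.range m, lp.single 2 j (star (a j)) with hy
  have hxn : ‖x‖ ^ 2 = ∑ k ∈ Finset.range n, ‖c k‖ ^ 2 := by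
    have h := lp.norm_sum_single (p := 2) (E := fun _ : ℕ => ℂ) (by norm_num) c (Finset.range n)
    simp only [ENNReal.toReal_ofNat, Real.rpow_ofNat] at h
    rw [← h, hx]
    congr 2
    refine Finset.sum_congr rfl fun k _ => ?_
    rw [← lp.single_smul, smul_eq_mul, mul_one]
  have hyn : ‖y‖ ^ 2 = ∑ j ∈ Finset.range m, ‖a j‖ ^ 2 := by
    have h := lp.norm_sum_single (p := 2) (E := fun _ : ℕ => ℂ) (by norm_num)
      (fun j => star (a j)) (Finset.range m)
    simpa only [ENNReal.toReal_ofNat, Real.rpow_ofNat, norm_star] using h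
  have hin : ∑ j ∈ Finset.range m, ∑ k ∈ Finset.range n, a j * b j k * c k = ⟪y, B x⟫_ℂ := by
    rw [hy, hx, sum_inner]
    refine Finset.sum_congr rfl fun j _ => ?_
    rw [map_sum, inner_sum]
    refine Finset.sum_congr rfl fun k _ => ?_
    rw [map_smul, inner_smul_right, lp.inner_single_left, hB]
    simp only [RCLike.inner_apply, RCLike.star_def, Complex.conj_conj]
    ring
  have hC0 : 0 ≤ C := (norm_nonneg B).trans hC
  rw [hin, ← hxn, ← hyn]
  calc ‖⟪y, B x⟫_ℂ‖ ≤ ‖y‖ * ‖B x‖ := norm_inner_le_norm _ _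
    _ ≤ ‖y‖ * (C * ‖x‖) := by gcongr; exact B.le_of_opNorm_le hC x
    _ = C * (‖y‖ * ‖x‖) := by ring
    _ ≤ _ := by
      gcongr
      nlinarith [sq_nonneg (‖y‖ - ‖x‖), sq_nonneg ‖x‖, sq_nonneg ‖y‖]

section Convergence

variable {ι ι₁ ι₃ P H : Type*} [NormedAddCommGroup H] [InnerProductSpace ℂ H]

/-- Uniformly bounded functionals that converge on a Hilbert basis converge everywhere. -/
theorem HilbertBasis.tendsto_clm_apply (b : HilbertBasis ι ℂ H) {l : Filter P}
    {φ : P → H →L[ℂ] ℂ} {ψ : H →L[ℂ] ℂ} {K : ℝ} (hK : ∀ p, ‖φ p‖ ≤ K)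
    (h : ∀ i, Tendsto (fun p => φ p (b i)) l (𝓝 (ψ (b i)))) (u : H) :
    Tendsto (fun p => φ p u) l (𝓝 (ψ u)) := by
  have hspan : ∀ w ∈ Submodule.span ℂ (Set.range b),
      Tendsto (fun p => φ p w) l (𝓝 (ψ w)) := fun w hw => by
    induction hw using Submodule.span_induction with
    | mem x hx =>
      obtain ⟨i, rfl⟩ := hx
      exact h i
    | zero => simpa using tendsto_const_nhds
    | add x y _ _ hx hy => simpa using hx.add hy
    | smul c x _ hx => simpa using hx.const_mul c
  have hu : u ∈ closure (Submodule.span ℂ (Set.range b) : Set H) := by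
    rw [← Submodule.topologicalClosure_coe, b.dense_span]
    trivial
  rw [Metric.tendsto_nhds]
  intro ε hε
  set M : ℝ := |K| + ‖ψ‖ + 1 with hM
  have hM0 : 0 < M := by positivity
  obtain ⟨w, hw, huw⟩ := Metric.mem_closure_iff.1 hu (ε / (2 * M)) (by positivity)
  filter_upwards [Metric.tendsto_nhds.1 (hspan w hw) (ε / 2) (by positivity)] with p hp
  rw [dist_eq_norm] at hp huw ⊢
  have e : φ p u - ψ u = (φ p w - ψ w) + (φ p (u - w) - ψ (u - w)) := by
    simp only [map_sub]; ring
  have h1 : ‖φ p (u - w) - ψ (u - w)‖ ≤ M * ‖u - w‖ := by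
    refine (norm_sub_le _ _).trans ?_
    have h1 := (φ p).le_of_opNorm_le ((hK p).trans (le_abs_self K)) (u - w)
    have h2 := ψ.le_opNorm (u - w)
    rw [hM]
    nlinarith [norm_nonneg (u - w)]
  have h2 : M * ‖u - w‖ < ε / 2 := by
    rw [lt_div_iff₀ (by positivity)] at huw
    linarith
  rw [e]
  exact (norm_add_le _ _).trans_lt (by linarith)

/-- Uniformly bounded operators whose matrix entries converge, converge in the weak operator
topology. -/
theorem tendsto_inner_of_tendsto_inner_basis (b₁ : HilbertBasis ι₁ ℂ H) (b₃ : HilbertBasis ι₃ ℂ H)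
    {l : Filter P} {S : P → H →L[ℂ] H} {W : H →L[ℂ] H} {K : ℝ} (hK : ∀ p, ‖S p‖ ≤ K)
    (h : ∀ i k, Tendsto (fun p => ⟪b₁ i, S p (b₃ k)⟫_ℂ) l (𝓝 ⟪b₁ i, W (b₃ k)⟫_ℂ)) (u v : H) :
    Tendsto (fun p => ⟪v, S p u⟫_ℂ) l (𝓝 ⟪v, W u⟫_ℂ) := by
  have h1 : ∀ i, Tendsto (fun p => ⟪b₁ i, S p u⟫_ℂ) l (𝓝 ⟪b₁ i, W u⟫_ℂ) := fun i =>
    b₃.tendsto_clm_apply (φ := fun p => (innerSL ℂ (b₁ i)).comp (S p))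
      (ψ := (innerSL ℂ (b₁ i)).comp W) (K := ‖innerSL ℂ (b₁ i)‖ * K)
      (fun p => (ContinuousLinearMap.opNorm_comp_le _ _).trans (by gcongr; exact hK p)) (h i) u
  have h2 := b₁.tendsto_clm_apply (φ := fun p => innerSL ℂ (S p u)) (ψ := innerSL ℂ (W u))
    (K := K * ‖u‖) (l := l)
    (fun p => by rw [innerSL_apply_norm]; exact (S p).le_of_opNorm_le (hK p) u)
    (fun i => by
      simpa only [innerSL_apply_apply, Function.comp_def, inner_conj_symm] using
        (Complex.continuous_conj.tendsto _).comp (h1 i)) v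
  simpa only [innerSL_apply_apply, Function.comp_def, inner_conj_symm] using
    (Complex.continuous_conj.tendsto _).comp h2

/-- The right-hand side need not be homogeneous of degree one in `u` and `v` separately: it is enough
to test on unit vectors. -/
theorem ContinuousLinearMap.opNorm_le_of_inner_le {A : H →L[ℂ] H} {K : ℝ}
    (h : ∀ u v : H, ‖⟪v, A u⟫_ℂ‖ ≤ K * (‖v‖ ^ 2 + ‖u‖ ^ 2)) : ‖A‖ ≤ |2 * K| := by
  refine A.opNorm_le_of_unit_norm (abs_nonneg _) fun u hu => ?_
  rcases eq_or_ne (A u) 0 with h0 | h0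
  · rw [h0, norm_zero]; positivity
  have hn : ‖A u‖ ≠ 0 := norm_ne_zero_iff.2 h0
  have h1 := h u (((‖A u‖⁻¹ : ℝ) : ℂ) • A u)
  rw [norm_smul, hu, inner_smul_left, Complex.conj_ofReal, norm_mul, Complex.norm_real,
    norm_inv, norm_norm, inv_mul_cancel₀ hn, inner_self_eq_norm_sq_to_K, norm_pow] at h1
  simp only [Complex.coe_algebraMap, Complex.norm_real, norm_norm] at h1
  have e : ‖A u‖⁻¹ * ‖A u‖ ^ 2 = ‖A u‖ := by field_simp
  rw [e] at h1
  exact h1.trans ((le_of_eq (by ring)).trans (le_abs_self _))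

end Convergence

/-! ### Triple operator integrals for atomic spectral measures -/

section Bound

variable {ι ι₁ ι₂ ι₃ H : Type*} [NormedAddCommGroup H] [InnerProductSpace ℂ H]

/-- If `∑ j, |h j i|² ≤ D` for every `i`, the diagonal operators with entries `h j` form a column
operator of norm at most `√D`. -/
theorem HilbertBasis.sum_norm_diagonal_sq_le (b : HilbertBasis ι ℂ H) {h : ℕ → ι → ℂ} {C : ℝ}
    (hh : ∀ j i, ‖h j i‖ ≤ C) {n : ℕ} {D : ℝ}
    (hD : ∀ i, ∑ j ∈ Finset.range n, ‖h j i‖ ^ 2 ≤ D) (u : H) :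
    ∑ j ∈ Finset.range n, ‖b.diagonal (h j) u‖ ^ 2 ≤ D * ‖u‖ ^ 2 := by
  refine hasSum_le (fun i => ?_)
    (hasSum_sum fun j _ => b.hasSum_norm_inner_diagonal_sq (hh j) u)
    ((b.hasSum_norm_inner_sq u).mul_left D)
  rw [← Finset.sum_mul]
  gcongr
  exact hD i

variable [CompleteSpace H]

/-- The rectangular partial sums of the triple operator integral are uniformly bounded. -/
theorem norm_sum_diagonal_mul_le (b₁ : HilbertBasis ι₁ ℂ H) (b₂ : HilbertBasis ι₂ ℂ H)
    (b₃ : HilbertBasis ι₃ ℂ H) (T R : H →L[ℂ] H) {α : ℕ → ι₁ → ℂ} {β : ℕ → ℕ → ι₂ → ℂ}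
    {γ : ℕ → ι₃ → ℂ} {K C₁ C₂ C₃ : ℝ} (hα : ∀ j i, ‖α j i‖ ≤ K)
    (hα' : ∀ n i, ∑ j ∈ Finset.range n, ‖α j i‖ ^ 2 ≤ C₁) (hβ : ∀ j k x, ‖β j k x‖ ≤ K)
    (hβ' : ∀ (a c : ℕ → ℂ) (m n : ℕ) (x : ι₂),
      ‖∑ j ∈ Finset.range m, ∑ k ∈ Finset.range n, a j * β j k x * c k‖ ≤
        C₂ * (∑ j ∈ Finset.range m, ‖a j‖ ^ 2 + ∑ k ∈ Finset.range n, ‖c k‖ ^ 2))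
    (hC₂ : 0 ≤ C₂) (hγ : ∀ k i, ‖γ k i‖ ≤ K)
    (hγ' : ∀ n i, ∑ k ∈ Finset.range n, ‖γ k i‖ ^ 2 ≤ C₃) (hC₁ : 0 ≤ C₁) (hC₃ : 0 ≤ C₃)
    (m n : ℕ) :
    ‖∑ j ∈ Finset.range m, ∑ k ∈ Finset.range n,
      b₁.diagonal (α j) * T * b₂.diagonal (β j k) * R * b₃.diagonal (γ k)‖ ≤
        |2 * (C₂ * (‖T‖ ^ 2 * C₁ + ‖R‖ ^ 2 * C₃))| := by
  refine ContinuousLinearMap.opNorm_le_of_inner_le fun u v => ?_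
  set a : ℕ → H := fun j =>
    ContinuousLinearMap.adjoint T (b₁.diagonal (fun i => star (α j i)) v) with ha
  set c : ℕ → H := fun k => R (b₃.diagonal (γ k) u) with hc
  have hterm : ∀ j k, ⟪v, (b₁.diagonal (α j) * T * b₂.diagonal (β j k) * R *
      b₃.diagonal (γ k)) u⟫_ℂ = ⟪a j, b₂.diagonal (β j k) (c k)⟫_ℂ := fun j k => by
    rw [ha, hc, ContinuousLinearMap.adjoint_inner_left, ← b₁.adjoint_diagonal (hα j),
      ContinuousLinearMap.adjoint_inner_left]
    rfl
  have hsum : HasSum (fun x => ∑ j ∈ Finset.range m, ∑ k ∈ Finset.range n,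
      ⟪a j, b₂ x⟫_ℂ * β j k x * ⟪b₂ x, c k⟫_ℂ)
      ⟪v, (∑ j ∈ Finset.range m, ∑ k ∈ Finset.range n,
        b₁.diagonal (α j) * T * b₂.diagonal (β j k) * R * b₃.diagonal (γ k)) u⟫_ℂ := by
    simp only [_root_.sum_apply, inner_sum, hterm]
    refine hasSum_sum fun j _ => hasSum_sum fun k _ => ?_
    exact (b₂.hasSum_inner_diagonal (hβ j k) (a j) (c k)).congr_fun fun x => by ring
  have hbound : HasSum (fun x => C₂ * (∑ j ∈ Finset.range m, ‖⟪b₂ x, a j⟫_ℂ‖ ^ 2 +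
      ∑ k ∈ Finset.range n, ‖⟪b₂ x, c k⟫_ℂ‖ ^ 2))
      (C₂ * (∑ j ∈ Finset.range m, ‖a j‖ ^ 2 + ∑ k ∈ Finset.range n, ‖c k‖ ^ 2)) :=
    ((hasSum_sum fun j _ => b₂.hasSum_norm_inner_sq (a j)).add
      (hasSum_sum fun k _ => b₂.hasSum_norm_inner_sq (c k))).mul_left C₂
  have hle := hsum.norm_le_of_bounded hbound fun x => by
    have h := hβ' (fun j => ⟪a j, b₂ x⟫_ℂ) (fun k => ⟪b₂ x, c k⟫_ℂ) m n x
    simpa only [norm_inner_symm] using h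
  have ha2 : ∑ j ∈ Finset.range m, ‖a j‖ ^ 2 ≤ ‖T‖ ^ 2 * (C₁ * ‖v‖ ^ 2) := by
    calc _ ≤ ∑ j ∈ Finset.range m,
          ‖T‖ ^ 2 * ‖b₁.diagonal (fun i => star (α j i)) v‖ ^ 2 := by
          refine Finset.sum_le_sum fun j _ => ?_
          rw [← mul_pow]
          gcongr
          refine (ContinuousLinearMap.le_opNorm _ _).trans (le_of_eq ?_)
          rw [LinearIsometryEquiv.norm_map]
      _ ≤ _ := by
          rw [← Finset.mul_sum]
          gcongr
          exact b₁.sum_norm_diagonal_sq_le (C := K) (by simpa using hα)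
            (by simpa using hα' m) v
  have hc2 : ∑ k ∈ Finset.range n, ‖c k‖ ^ 2 ≤ ‖R‖ ^ 2 * (C₃ * ‖u‖ ^ 2) := by
    calc _ ≤ ∑ k ∈ Finset.range n, ‖R‖ ^ 2 * ‖b₃.diagonal (γ k) u‖ ^ 2 := by
          refine Finset.sum_le_sum fun j _ => ?_
          rw [← mul_pow]
          gcongr
          exact ContinuousLinearMap.le_opNorm _ _
      _ ≤ _ := by
          rw [← Finset.mul_sum]
          gcongr
          exact b₃.sum_norm_diagonal_sq_le hγ (hγ' n) u
  refine hle.trans ?_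
  rw [mul_assoc]
  gcongr
  calc _ ≤ ‖T‖ ^ 2 * (C₁ * ‖v‖ ^ 2) + ‖R‖ ^ 2 * (C₃ * ‖u‖ ^ 2) := add_le_add ha2 hc2
    _ ≤ _ := by
      have h1 : 0 ≤ ‖T‖ ^ 2 * C₁ * ‖u‖ ^ 2 := by positivity
      have h2 : 0 ≤ ‖R‖ ^ 2 * C₃ * ‖v‖ ^ 2 := by positivity
      nlinarith

end Bound

namespace SpectralMeasure

variable {ι ι₁ ι₂ ι₃ X X₁ X₂ X₃ H : Type*} [MeasurableSpace X] [MeasurableSpace X₁]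
  [MeasurableSpace X₂] [MeasurableSpace X₃] [MeasurableSingletonClass X] [MeasurableSingletonClass X₁]
  [MeasurableSingletonClass X₂] [MeasurableSingletonClass X₃] [NormedAddCommGroup H]
  [InnerProductSpace ℂ H] [CompleteSpace H]

theorem MemLinftyEll2.exists_bound_atomic [Countable ι] {b : HilbertBasis ι ℂ H} {g : ι → X}
    {α : ℕ → X → ℂ} (h : (atomic b g).MemLinftyEll2 α) : ∃ C, 0 ≤ C ∧ (∀ j i, ‖α j (g i)‖ ≤ C) ∧
      ∀ n i, ∑ j ∈ Finset.range n, ‖α j (g i)‖ ^ 2 ≤ C := by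
  obtain ⟨-, C, hC⟩ := h
  rw [ae_atomic_iff] at hC
  have hs : ∀ n i, ∑ j ∈ Finset.range n, ‖α j (g i)‖ ^ 2 ≤ |C| + 1 := fun n i =>
    ((hC i).1.sum_le_tsum _ fun _ _ => by positivity).trans
      ((hC i).2.trans ((le_abs_self C).trans (by linarith)))
  refine ⟨|C| + 1, by positivity, fun j i => ?_, hs⟩
  have h1 := (Finset.single_le_sum (f := fun j => ‖α j (g i)‖ ^ 2) (fun _ _ => by positivity)
    (Finset.self_mem_range_succ j)).trans (hs (j + 1) i)
  refine abs_le_of_sq_le_sq' ?_ (by positivity) |>.2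
  nlinarith [abs_nonneg C]

/-- The bound on the partial sums is stated through squares, as in `norm_sum_range_matrix_le`. -/
theorem MemLinftyMatrix.exists_bound_atomic [Countable ι] {b : HilbertBasis ι ℂ H} {g : ι → X}
    {β : ℕ → ℕ → X → ℂ} (h : (atomic b g).MemLinftyMatrix β) :
    ∃ C, 0 ≤ C ∧ (∀ j k i, ‖β j k (g i)‖ ≤ C) ∧ ∀ (a c : ℕ → ℂ) (m n : ℕ) (i : ι),
      ‖∑ j ∈ Finset.range m, ∑ k ∈ Finset.range n, a j * β j k (g i) * c k‖ ≤
        C * (∑ j ∈ Finset.range m, ‖a j‖ ^ 2 + ∑ k ∈ Finset.range n, ‖c k‖ ^ 2) := by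
  obtain ⟨-, C, hC⟩ := h
  rw [ae_atomic_iff] at hC
  refine ⟨|C|, abs_nonneg C, fun j k i => ?_, fun a c m n i => ?_⟩
  · obtain ⟨B, hB, hB'⟩ := hC i
    rw [← hB']
    refine (lp.norm_apply_le_norm (by norm_num) _ j).trans ?_
    refine (B.le_opNorm _).trans ?_
    rw [lp.norm_single (by norm_num), norm_one, mul_one]
    exact hB.trans (le_abs_self C)
  · obtain ⟨B, hB, hB'⟩ := hC i
    exact norm_sum_range_matrix_le hB' (hB.trans (le_abs_self C)) a c m n

/-- With respect to atomic spectral measures a Haagerup representation holds at every triple of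
atoms: the scalar measures of basis vectors are Dirac measures. -/
theorem IsHaagerupRepresentation.tendsto_atomic {b₁ : HilbertBasis ι₁ ℂ H}
    {b₂ : HilbertBasis ι₂ ℂ H} {b₃ : HilbertBasis ι₃ ℂ H} {g₁ : ι₁ → X₁} {g₂ : ι₂ → X₂}
    {g₃ : ι₃ → X₃} {Ψ : X₁ → X₂ → X₃ → ℂ} {α β γ}
    (h : IsHaagerupRepresentation (atomic b₁ g₁) (atomic b₂ g₂) (atomic b₃ g₃) Ψ α β γ)
    (i : ι₁) (x : ι₂) (k : ι₃) :
    Tendsto (fun p : ℕ × ℕ => ∑ j ∈ Finset.range p.1, ∑ l ∈ Finset.range p.2,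
      α j (g₁ i) * β j l (g₂ x) * γ l (g₃ k)) atTop (𝓝 (Ψ (g₁ i) (g₂ x) (g₃ k))) := by
  have := h.2.2.2 (b₁ i) (b₂ x) (b₃ k)
  rwa [scalarMeasure_atomic_basis, scalarMeasure_atomic_basis, scalarMeasure_atomic_basis,
    Measure.dirac_prod_dirac, Measure.dirac_prod_dirac, ae_dirac_eq] at this

/-- For atomic spectral measures the triple operator integral is determined by its matrix entries.
On a pair of basis vectors the series reduces to `ℓ¹`-convergence in the middle variable. -/
theorem isTripleOperatorIntegral_atomic [Countable ι₁] [Countable ι₂] [Countable ι₃]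
    {b₁ : HilbertBasis ι₁ ℂ H}
    {b₂ : HilbertBasis ι₂ ℂ H} {b₃ : HilbertBasis ι₃ ℂ H} {g₁ : ι₁ → X₁} {g₂ : ι₂ → X₂}
    {g₃ : ι₃ → X₃} {Ψ : X₁ → X₂ → X₃ → ℂ} {T R W : H →L[ℂ] H}
    (hΨ : MemHaagerup (atomic b₁ g₁) (atomic b₂ g₂) (atomic b₃ g₃) Ψ)
    (hW : ∀ i k, ⟪b₁ i, W (b₃ k)⟫_ℂ =
      ∑' x, Ψ (g₁ i) (g₂ x) (g₃ k) * (⟪b₁ i, T (b₂ x)⟫_ℂ * ⟪b₂ x, R (b₃ k)⟫_ℂ)) :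
    IsTripleOperatorIntegral (atomic b₁ g₁) (atomic b₂ g₂) (atomic b₃ g₃) Ψ T R W := by
  refine ⟨hΨ, fun α β γ h => ?_⟩
  obtain ⟨C₁, hC₁, hα, hα'⟩ := h.1.exists_bound_atomic
  obtain ⟨C₂, hC₂, hβ, hβ'⟩ := h.2.1.exists_bound_atomic
  obtain ⟨C₃, hC₃, hγ, hγ'⟩ := h.2.2.1.exists_bound_atomic
  have e1 : ∀ j, (atomic b₁ g₁).integral (α j) = b₁.diagonal fun i => α j (g₁ i) := fun j =>
    integral_atomic b₁ g₁ (h.1.1 j) (hα j)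
  have e2 : ∀ j k, (atomic b₂ g₂).integral (β j k) = b₂.diagonal fun i => β j k (g₂ i) :=
    fun j k => integral_atomic b₂ g₂ (h.2.1.1 j k) (hβ j k)
  have e3 : ∀ k, (atomic b₃ g₃).integral (γ k) = b₃.diagonal fun i => γ k (g₃ i) := fun k =>
    integral_atomic b₃ g₃ (h.2.2.1.1 k) (hγ k)
  simp only [e1, e2, e3]
  refine tendsto_inner_of_tendsto_inner_basis b₁ b₃ (fun p =>
    norm_sum_diagonal_mul_le b₁ b₂ b₃ T R (K := max C₁ (max C₂ C₃))
      (fun j i => (hα j i).trans (by simp)) hα' (fun j k x => (hβ j k x).trans (by simp)) hβ' hC₂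
      (fun k i => (hγ k i).trans (by simp)) hγ' hC₁ hC₃ p.1 p.2) fun i k => ?_
  have hent : ∀ p : ℕ × ℕ, ⟪b₁ i, (∑ j ∈ Finset.range p.1, ∑ l ∈ Finset.range p.2,
      b₁.diagonal (fun i => α j (g₁ i)) * T * b₂.diagonal (fun i => β j l (g₂ i)) * R *
        b₃.diagonal fun i => γ l (g₃ i)) (b₃ k)⟫_ℂ =
      ∑' x, (∑ j ∈ Finset.range p.1, ∑ l ∈ Finset.range p.2,
        α j (g₁ i) * β j l (g₂ x) * γ l (g₃ k)) *
          (⟪b₁ i, T (b₂ x)⟫_ℂ * ⟪b₂ x, R (b₃ k)⟫_ℂ) := fun p => by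
    simp only [_root_.sum_apply, inner_sum, Finset.sum_mul]
    refine (HasSum.tsum_eq (hasSum_sum fun j _ => hasSum_sum fun l _ => ?_)).symm
    have h1 := (b₂.hasSum_inner_diagonal (hβ j l) (ContinuousLinearMap.adjoint T (b₁ i))
      (R (b₃ k))).mul_left (α j (g₁ i) * γ l (g₃ k))
    have hval : ⟪b₁ i, (b₁.diagonal (fun i => α j (g₁ i)) * T *
        b₂.diagonal (fun i => β j l (g₂ i)) * R * b₃.diagonal fun i => γ l (g₃ i)) (b₃ k)⟫_ℂ =
        α j (g₁ i) * γ l (g₃ k) * ⟪ContinuousLinearMap.adjoint T (b₁ i),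
          b₂.diagonal (fun i => β j l (g₂ i)) (R (b₃ k))⟫_ℂ := by
      simp only [_root_.mul_apply_eq_comp]
      rw [b₃.diagonal_apply_self (hγ l), b₁.inner_diagonal (hα j), map_smul, map_smul, map_smul,
        inner_smul_right, ContinuousLinearMap.adjoint_inner_left]
      ring
    rw [hval]
    refine h1.congr_fun fun x => ?_
    rw [ContinuousLinearMap.adjoint_inner_left]
    ring
  simp only [hent]
  rw [hW]
  have hsm : Summable fun x =>
      ‖⟪b₁ i, T (b₂ x)⟫_ℂ * ⟪b₂ x, R (b₃ k)⟫_ℂ‖ := by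
    have h1 := (b₂.summable_inner_mul_inner (ContinuousLinearMap.adjoint T (b₁ i))
      (R (b₃ k))).norm
    simpa only [ContinuousLinearMap.adjoint_inner_left] using h1
  refine tendsto_tsum_of_dominated_convergence (hsm.mul_left (C₂ * (C₁ + C₃))) (fun x => ?_)
    (Eventually.of_forall fun p x => ?_)
  · exact (h.tendsto_atomic i x k).mul_const _
  · rw [norm_mul]
    gcongr
    refine (hβ' (fun j => α j (g₁ i)) (fun l => γ l (g₃ k)) p.1 p.2 x).trans ?_
    gcongr
    · exact hα' _ _
    · exact hγ' _ _

end SpectralMeasure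

/-! ### Trace class operators -/

section TraceClass

variable {ι H : Type*} [NormedAddCommGroup H] [InnerProductSpace ℂ H] [CompleteSpace H]

theorem IsTraceClass.summable_inner_abs {T : H →L[ℂ] H} (hT : IsTraceClass T)
    (b : HilbertBasis ι ℂ H) : Summable fun i => (⟪b i, CFC.abs T (b i)⟫_ℂ).re := by
  have hsp : ⊤ ≤ (Submodule.span ℂ
      (Set.range (Subtype.val : Set.range b → H))).topologicalClosure := by
    rw [Subtype.range_coe, b.dense_span]
  obtain ⟨b', hb'⟩ : ∃ b' : HilbertBasis (Set.range b) ℂ H, ⇑b' = Subtype.val :=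
    ⟨HilbertBasis.mk b.orthonormal.toSubtypeRange hsp, HilbertBasis.coe_mk _ _⟩
  have h := hT (Set.range b) b'
  simp only [hb'] at h
  have hinj : Function.Injective (Set.rangeFactorization b) :=
    Set.rangeFactorization_injective.2 b.orthonormal.linearIndependent.injective
  exact (h.comp_injective hinj :)

theorem isTraceClass_rankOne (v w : H) : IsTraceClass (InnerProductSpace.rankOne ℂ v w) := by
  -- if `w = 0` both sides vanish, so the division by `‖w‖` is harmless
  have habs : CFC.abs (InnerProductSpace.rankOne ℂ v w) =
      ((‖v‖ / ‖w‖ : ℝ) : ℂ) • InnerProductSpace.rankOne ℂ w w := by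
    have hpos : 0 ≤ ((‖v‖ / ‖w‖ : ℝ) : ℂ) • InnerProductSpace.rankOne ℂ w w := by
      rw [ContinuousLinearMap.nonneg_iff_isPositive]
      exact (InnerProductSpace.isPositive_rankOne_self w).smul_of_nonneg
        (Complex.zero_le_real.2 (by positivity))
    refine CFC.sqrt_unique ?_ hpos
    ext u
    rw [ContinuousLinearMap.star_eq_adjoint, InnerProductSpace.adjoint_rankOne]
    simp only [_root_.mul_apply_eq_comp, _root_.smul_apply, InnerProductSpace.rankOne_apply,
      map_smul, smul_smul, inner_self_eq_norm_sq_to_K, Complex.coe_algebraMap]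
    rcases eq_or_ne w 0 with rfl | hw
    · simp
    congr 1
    have hw' : (‖w‖ : ℂ) ≠ 0 := by simpa using hw
    push_cast
    field_simp
  intro s b
  rw [habs]
  refine ((b.hasSum_norm_inner_sq w).summable.mul_left (‖v‖ / ‖w‖)).congr fun i => ?_
  rw [_root_.smul_apply, InnerProductSpace.rankOne_apply, inner_smul_right, inner_smul_right,
    ← inner_conj_symm w, ← Complex.normSq_eq_conj_mul_self, Complex.normSq_eq_norm_sq,
    ← Complex.ofReal_mul, Complex.ofReal_re]

theorem HilbertBasis.abs_diagonal (b : HilbertBasis ι ℂ H) {d : ι → ℝ} (hd : ∀ i, 0 ≤ d i) {C : ℝ}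
    (hC : ∀ i, d i ≤ C) :
    CFC.abs (b.diagonal fun i => (d i : ℂ)) = b.diagonal fun i => (d i : ℂ) := by
  have hC' : ∀ i, ‖(d i : ℂ)‖ ≤ C := fun i => by
    rw [Complex.norm_real, Real.norm_of_nonneg (hd i)]
    exact hC i
  have hpos : 0 ≤ b.diagonal fun i => (d i : ℂ) := by
    rw [ContinuousLinearMap.nonneg_iff_isPositive, ContinuousLinearMap.isPositive_def']
    refine ⟨?_, fun u => ?_⟩
    · rw [IsSelfAdjoint, ContinuousLinearMap.star_eq_adjoint, b.adjoint_diagonal hC']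
      simp only [RCLike.star_def, Complex.conj_ofReal]
    · rw [ContinuousLinearMap.reApplyInnerSelf_apply, inner_re_symm]
      refine ((b.hasSum_inner_diagonal_self hC' u).mapL Complex.reCLM).nonneg fun i => ?_
      rw [Complex.reCLM_apply, ← Complex.ofReal_mul, Complex.ofReal_re]
      exact mul_nonneg (hd i) (by positivity)
  exact CFC.abs_of_nonneg _ hpos

theorem HilbertBasis.summable_of_isTraceClass_diagonal (b : HilbertBasis ι ℂ H) {d : ι → ℝ}
    (hd : ∀ i, 0 ≤ d i) {C : ℝ} (hC : ∀ i, d i ≤ C)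
    (h : IsTraceClass (b.diagonal fun i => (d i : ℂ))) : Summable d := by
  classical
  have h1 := h.summable_inner_abs b
  rw [b.abs_diagonal hd hC] at h1
  refine h1.congr fun i => ?_
  rw [b.inner_diagonal (C := C), b.inner_basis, if_pos rfl, mul_one, Complex.ofReal_re]
  intro i
  rw [Complex.norm_real, Real.norm_of_nonneg (hd i)]
  exact hC i

end TraceClass

/-! ### Block diagonal changes of basis -/

section Block

variable {ν H : Type*} {κ : ν → Type*} [∀ n, Fintype (κ n)] [NormedAddCommGroup H]
  [InnerProductSpace ℂ H]

/-- The image of a Hilbert basis indexed by `Σ n, κ n` under the block diagonal unitary operator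
with blocks `U n`. -/
noncomputable def blockFamily (b : HilbertBasis (Σ n, κ n) ℂ H)
    (U : ∀ n, Matrix (κ n) (κ n) ℂ) (p : Σ n, κ n) : H :=
  ∑ y, U p.1 y p.2 • b ⟨p.1, y⟩

variable (b : HilbertBasis (Σ n, κ n) ℂ H) {U : ∀ n, Matrix (κ n) (κ n) ℂ}

theorem inner_blockFamily (n : ν) (x y : κ n) : ⟪b ⟨n, y⟩, blockFamily b U ⟨n, x⟩⟫_ℂ = U n y x := by
  classical
  rw [blockFamily, inner_sum, Finset.sum_eq_single y]
  · rw [inner_smul_right, b.inner_basis, if_pos rfl, mul_one]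
  · intro z _ hz
    rw [inner_smul_right, b.inner_basis, if_neg (by simpa using hz.symm), mul_zero]
  · simp

theorem inner_blockFamily_of_ne {p q : Σ n, κ n} (h : p.1 ≠ q.1) :
    ⟪b p, blockFamily b U q⟫_ℂ = 0 := by
  classical
  rw [blockFamily, inner_sum]
  refine Finset.sum_eq_zero fun z _ => ?_
  rw [inner_smul_right, b.inner_basis, if_neg, mul_zero]
  rintro rfl
  exact h rfl

theorem HilbertBasis.exists_inner_eq_of_summable_sum {c : (Σ n, κ n) → ℂ}
    (hc : Summable fun n => ∑ y, ‖c ⟨n, y⟩‖ ^ 2) : ∃ v : H, ∀ p, ⟪b p, v⟫_ℂ = c p := by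
  have hm : Memℓp c 2 := by
    refine memℓp_gen ((summable_sigma_of_nonneg fun _ => by positivity).2
      ⟨fun n => Summable.of_finite, ?_⟩)
    simpa [tsum_fintype] using hc
  exact ⟨b.repr.symm ⟨c, hm⟩, fun p => by rw [← b.repr_apply_apply]; simp⟩

variable [∀ n, DecidableEq (κ n)]

theorem orthonormal_blockFamily (hU : ∀ n, U n ∈ Matrix.unitaryGroup (κ n) ℂ) :
    Orthonormal ℂ (blockFamily b U) := by
  classical
  rw [orthonormal_iff_ite]
  rintro ⟨m, x⟩ ⟨n, x'⟩
  rw [blockFamily, sum_inner]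
  simp only [inner_smul_left]
  rcases eq_or_ne m n with rfl | hmn
  · simp only [inner_blockFamily]
    have h := congrFun (congrFun (Matrix.mem_unitaryGroup_iff'.1 (hU m)) x) x'
    rw [Matrix.mul_apply, Matrix.one_apply] at h
    simpa [Matrix.star_apply] using h
  · rw [if_neg (by rintro ⟨⟩; exact hmn rfl)]
    refine Finset.sum_eq_zero fun y _ => ?_
    rw [inner_blockFamily_of_ne b (p := ⟨m, y⟩) (q := ⟨n, x'⟩) hmn, mul_zero]

theorem sum_star_smul_blockFamily (hU : ∀ n, U n ∈ Matrix.unitaryGroup (κ n) ℂ) (n : ν) (y : κ n) :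
    ∑ x, star (U n y x) • blockFamily b U ⟨n, x⟩ = b ⟨n, y⟩ := by
  classical
  refine b.ext_inner fun ⟨m, z⟩ => ?_
  rw [inner_sum, b.inner_basis]
  simp only [inner_smul_right]
  rcases eq_or_ne m n with rfl | hmn
  · simp only [inner_blockFamily]
    have h := congrFun (congrFun (Matrix.mem_unitaryGroup_iff.1 (hU m)) z) y
    rw [Matrix.mul_apply, Matrix.one_apply] at h
    simpa [Matrix.star_apply, mul_comm] using h
  · rw [if_neg (by rintro ⟨⟩; exact hmn rfl)]
    refine Finset.sum_eq_zero fun x _ => ?_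
    rw [inner_blockFamily_of_ne b (p := ⟨m, z⟩) (q := ⟨n, x⟩) hmn, mul_zero]

theorem exists_hilbertBasis_blockFamily [CompleteSpace H]
    (hU : ∀ n, U n ∈ Matrix.unitaryGroup (κ n) ℂ) :
    ∃ f : HilbertBasis (Σ n, κ n) ℂ H, ⇑f = blockFamily b U := by
  refine ⟨HilbertBasis.mk (orthonormal_blockFamily b hU) ?_, HilbertBasis.coe_mk _ _⟩
  rw [← b.dense_span]
  refine Submodule.topologicalClosure_mono (Submodule.span_le.2 ?_)
  rintro _ ⟨⟨n, y⟩, rfl⟩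
  rw [← sum_star_smul_blockFamily b hU]
  exact Submodule.sum_mem _ fun x _ => Submodule.smul_mem _ _ (Submodule.subset_span ⟨_, rfl⟩)

/-- The normalized character table of `ℤ/N` is a unitary matrix all of whose entries have the same
modulus. -/
theorem exists_unitary_norm_eq (N : ℕ) [NeZero N] :
    ∃ U ∈ Matrix.unitaryGroup (ZMod N) ℂ, ∀ y x, ‖U y x‖ = (√N)⁻¹ := by
  refine ⟨Matrix.of fun y x => (((√N)⁻¹ : ℝ) : ℂ) * ZMod.stdAddChar (y * x), ?_, fun y x => ?_⟩
  · rw [Matrix.mem_unitaryGroup_iff]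
    ext y z
    rw [Matrix.mul_apply, Matrix.one_apply]
    have hN : (N : ℝ) ≠ 0 := Nat.cast_ne_zero.2 (NeZero.ne N)
    have hs : (((√N)⁻¹ : ℝ) : ℂ) * (((√N)⁻¹ : ℝ) : ℂ) = (N : ℂ)⁻¹ := by
      rw [← Complex.ofReal_mul, ← mul_inv, Real.mul_self_sqrt (by positivity)]
      push_cast
      rfl
    have hterm : ∀ x : ZMod N, (((√N)⁻¹ : ℝ) : ℂ) * ZMod.stdAddChar (y * x) *
        star ((((√N)⁻¹ : ℝ) : ℂ) * ZMod.stdAddChar (z * x)) =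
          (N : ℂ)⁻¹ * ZMod.stdAddChar (x * (y - z)) := fun x => by
      have e : x * (y - z) = y * x + -(z * x) := by ring
      rw [e, AddChar.map_add_eq_mul, AddChar.map_neg_eq_conj, star_mul', ← hs]
      simp only [RCLike.star_def, Complex.conj_ofReal]
      ring
    simp only [Matrix.star_apply, Matrix.of_apply, hterm]
    rw [← Finset.mul_sum, AddChar.sum_mulShift _ (ZMod.isPrimitive_stdAddChar N)]
    simp only [sub_eq_zero, ZMod.card]
    split_ifs
    · exact inv_mul_cancel₀ (by exact_mod_cast hN)
    · simp
  · rw [Matrix.of_apply, norm_mul, Complex.norm_real, AddChar.norm_apply, mul_one,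
      Real.norm_of_nonneg (by positivity)]

end Block

/-! ### A symbol supported on the diagonal -/

namespace SpectralMeasure

section DiagonalSymbol

variable {H : Type*} [NormedAddCommGroup H] [InnerProductSpace ℂ H] [CompleteSpace H]

/-- The family of functions on `ℝ` indexed by `j`, equal to `1` where `⌊x⌋₊ = j` and to `0`
elsewhere.  On the atoms `x ∈ ℕ` it is the coordinate family `δ_j`; the use of `⌊x⌋₊`, which is `0` for
negative `x`, gives exactly one nonzero member at every real point. -/
noncomputable def floorIndicator (j : ℕ) (x : ℝ) : ℂ := if ⌊x⌋₊ = j then 1 else 0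

theorem memLinftyEll2_floorIndicator (E : SpectralMeasure ℝ H) :
    E.MemLinftyEll2 floorIndicator := by
  refine ⟨fun j => ?_, 1, fun u => Eventually.of_forall fun x => ?_⟩
  · exact (measurable_from_nat (f := fun n : ℕ => if n = j then (1 : ℂ) else 0)).comp
      Nat.measurable_floor
  · have h : HasSum (fun j => ‖floorIndicator j x‖ ^ 2) 1 := by
      convert hasSum_ite_eq ⌊x⌋₊ (1 : ℝ) using 2 with j
      rw [floorIndicator]
      rcases eq_or_ne ⌊x⌋₊ j with h | h
      · simp [h]
      · simp [h, h.symm]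
    exact ⟨h.summable, h.tsum_eq.le⟩

/-- A representation of a symbol that vanishes unless the integer parts of its outer variables
agree.  Its middle matrix is diagonal at every point. -/
theorem isHaagerupRepresentation_floorIndicator (E₁ E₂ E₃ : SpectralMeasure ℝ H)
    {h : ℕ → ℕ → ℂ} (hh : ∀ j n, ‖h j n‖ ≤ 1) :
    IsHaagerupRepresentation E₁ E₂ E₃
      (fun x y z => if ⌊x⌋₊ = ⌊z⌋₊ then h ⌊x⌋₊ ⌊y⌋₊ else 0) floorIndicator
      (fun j k y => if j = k then h j ⌊y⌋₊ else 0) floorIndicator := by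
  refine ⟨memLinftyEll2_floorIndicator E₁, ⟨fun j k => ?_, 1, fun u => Eventually.of_forall
    fun y => ?_⟩, memLinftyEll2_floorIndicator E₃, fun u₁ u₂ u₃ => Eventually.of_forall fun x => ?_⟩
  · exact (measurable_from_nat (f := fun n : ℕ => if j = k then h j n else 0)).comp
      Nat.measurable_floor
  · set b : HilbertBasis ℕ ℂ (lp (fun _ : ℕ => ℂ) 2) :=
      HilbertBasis.ofRepr (LinearIsometryEquiv.refl ℂ _) with hb
    have hs : ∀ k, lp.single 2 k (1 : ℂ) = b k := fun k => b.repr_symm_single k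
    refine ⟨b.diagonal fun j => h j ⌊y⌋₊, b.norm_diagonal_le zero_le_one fun j => hh j _,
      fun j k => ?_⟩
    have hr := b.repr_apply_apply (b.diagonal (fun j => h j ⌊y⌋₊) (b k)) j
    rw [b.inner_diagonal fun j => hh j _, b.inner_basis, mul_ite, mul_one, mul_zero] at hr
    rw [hs]
    exact hr
  · refine tendsto_const_nhds.congr' ?_
    filter_upwards [eventually_ge_atTop (⌊x.1⌋₊ + 1, ⌊x.2.2⌋₊ + 1)] with p hp
    have h1 : ⌊x.1⌋₊ ∈ Finset.range p.1 := Finset.mem_range.2 hp.1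
    have h2 : ⌊x.2.2⌋₊ ∈ Finset.range p.2 := Finset.mem_range.2 hp.2
    rw [Finset.sum_eq_single_of_mem _ h1, Finset.sum_eq_single_of_mem _ h2]
    · simp [floorIndicator]
    · intro k _ hk
      simp [floorIndicator, hk.symm]
    · intro j _ hj
      simp [floorIndicator, hj.symm]

end DiagonalSymbol

/-- If the nonnegative numbers `d i = ⟪w, b i⟫ * ∑ x, |⟪b i, f x⟫ ⟪f x, v⟫|` are not summable, a symbol
that aligns the phases of `⟪b i, f x⟫ ⟪f x, v⟫` sends the rank one operator `⟪w, ·⟫ v` out of the trace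
class: the triple operator integral is the diagonal operator with entries `d i`. -/
theorem exists_tripleOperatorIntegral_not_isTraceClass {ι H : Type*} [NormedAddCommGroup H]
    [InnerProductSpace ℂ H] [CompleteSpace H] (b f : HilbertBasis ι ℂ H) (e : ι ≃ ℕ) {v w : H}
    {d : ι → ℝ} (hd : ∀ i, 0 ≤ d i) {C : ℝ} (hC : ∀ i, d i ≤ C) (hdS : ¬ Summable d)
    (hdw : ∀ i, (d i : ℂ) = ⟪w, b i⟫_ℂ * ∑' x, (‖⟪b i, f x⟫_ℂ * ⟪f x, v⟫_ℂ‖ : ℂ)) :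
    ∃ (E₁ E₂ E₃ : SpectralMeasure ℝ H) (Ψ : ℝ → ℝ → ℝ → ℂ) (Q W : H →L[ℂ] H),
      MemHaagerup E₁ E₂ E₃ Ψ ∧ IsTraceClass Q ∧
        IsTripleOperatorIntegral E₁ E₂ E₃ Ψ 1 Q W ∧ ¬ IsTraceClass W := by
  have : Countable ι := e.injective.countable
  set g : ι → ℝ := fun i => (e i : ℝ) with hg
  -- the phase of `⟪b i, f x⟫ ⟪f x, v⟫`, conjugated; it is `0` where the product vanishes
  set φ : ι → ι → ℂ := fun i x =>
    star (⟪b i, f x⟫_ℂ * ⟪f x, v⟫_ℂ) / (‖⟪b i, f x⟫_ℂ * ⟪f x, v⟫_ℂ‖ : ℂ) with hφ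
  have hφ1 : ∀ i x, ‖φ i x‖ ≤ 1 := fun i x => by
    rw [hφ]
    simp only [norm_div, norm_star, Complex.norm_real, norm_norm]
    exact div_self_le_one _
  have hφ2 : ∀ i x, φ i x * (⟪b i, f x⟫_ℂ * ⟪f x, v⟫_ℂ) = (‖⟪b i, f x⟫_ℂ * ⟪f x, v⟫_ℂ‖ : ℂ) :=
    fun i x => by
      rw [hφ]
      beta_reduce
      generalize ⟪b i, f x⟫_ℂ * ⟪f x, v⟫_ℂ = z
      rcases eq_or_ne z 0 with rfl | hz
      · simp
      have hz' : (‖z‖ : ℂ) ≠ 0 := by simpa using hz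
      simp only [RCLike.star_def]
      rw [div_mul_eq_mul_div, Complex.conj_mul', pow_two, mul_div_cancel_right₀ _ hz']
  have hΨ : MemHaagerup (atomic b g) (atomic f g) (atomic b g) _ :=
    ⟨_, _, _, isHaagerupRepresentation_floorIndicator _ _ _
      (h := fun j n => φ (e.symm j) (e.symm n)) fun j n => hφ1 _ _⟩
  refine ⟨_, _, _, _, InnerProductSpace.rankOne ℂ v w, b.diagonal fun i => (d i : ℂ), hΨ,
    isTraceClass_rankOne v w, isTripleOperatorIntegral_atomic hΨ fun i k => ?_,
    fun h => hdS (b.summable_of_isTraceClass_diagonal hd hC h)⟩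
  have hC' : ∀ i, ‖(d i : ℂ)‖ ≤ C := fun i => by
    rw [Complex.norm_real, Real.norm_of_nonneg (hd i)]
    exact hC i
  classical
  rw [b.inner_diagonal hC', b.inner_basis]
  simp only [hg, Nat.floor_natCast, e.symm_apply_apply, e.apply_eq_iff_eq,
    InnerProductSpace.rankOne_apply, inner_smul_right, one_apply_eq_self]
  split_ifs with hik
  · subst hik
    rw [mul_one, hdw, ← tsum_mul_left]
    refine tsum_congr fun x => ?_
    rw [← hφ2]
    ring
  · simp

end SpectralMeasure

/-! ### The Fourier matrix example -/

theorem theorem3p1 :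
    ∃ (E₁ E₂ E₃ : SpectralMeasure ℝ (lp (fun _ : ℕ => ℂ) 2)) (Ψ : ℝ → ℝ → ℝ → ℂ)
      (Q W : lp (fun _ : ℕ => ℂ) 2 →L[ℂ] lp (fun _ : ℕ => ℂ) 2),
      SpectralMeasure.MemHaagerup E₁ E₂ E₃ Ψ ∧ IsTraceClass Q ∧
        SpectralMeasure.IsTripleOperatorIntegral E₁ E₂ E₃ Ψ 1 Q W ∧ ¬ IsTraceClass W := by
  classical
  -- Blocks of size `N = (n + 1) ^ 4`: with `a = 1 / (n + 1)` the entries of the resulting diagonal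
  -- operator in the `n`-th block are `a * (a / √N) = 1 / N`, and they sum to `1`.
  let N : ℕ → ℕ := fun n => (n + 1) ^ 4
  have : ∀ n, NeZero (N n) := fun n => ⟨by positivity⟩
  have hN : ∀ n, (N n : ℝ) = ((n : ℝ) + 1) ^ 4 := fun n => by
    simp only [N]
    push_cast
    rfl
  have hsqrt : ∀ n, √(N n : ℝ) = ((n : ℝ) + 1) ^ 2 := fun n => by
    rw [Real.sqrt_eq_iff_mul_self_eq (by positivity) (by positivity), hN]
    ring
  have : Infinite (Σ n, ZMod (N n)) :=
    Infinite.of_injective (fun n => ⟨n, 0⟩) fun m n h => congrArg Sigma.fst h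
  obtain ⟨e⟩ : Nonempty ((Σ n, ZMod (N n)) ≃ ℕ) := nonempty_equiv_of_countable
  obtain ⟨b, -⟩ := (HilbertBasis.ofRepr
    (LinearIsometryEquiv.refl ℂ (lp (fun _ : ℕ => ℂ) 2))).exists_comp_equiv e
  choose U hU hUn using fun n => exists_unitary_norm_eq (N n)
  obtain ⟨f, hf⟩ := exists_hilbertBasis_blockFamily b hU
  have hsq : Summable fun n : ℕ => ((((n : ℝ) + 1) ^ 2)⁻¹) := by
    have h := (summable_nat_add_iff 1).2 (Real.summable_nat_pow_inv.2 one_lt_two)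
    exact_mod_cast h
  obtain ⟨v, hv⟩ := b.exists_inner_eq_of_summable_sum
    (c := fun p => if p.2 = 0 then (((p.1 : ℝ) + 1)⁻¹ : ℝ) else (0 : ℂ)) (by
      refine hsq.congr fun n => ?_
      rw [Finset.sum_eq_single_of_mem 0 (Finset.mem_univ _)]
      · rw [if_pos rfl, Complex.norm_real, Real.norm_of_nonneg (by positivity), inv_pow]
      · intro y _ hy
        simp [hy])
  obtain ⟨w, hw⟩ := b.exists_inner_eq_of_summable_sum
    (c := fun p => (((((p.1 : ℝ) + 1) ^ 3)⁻¹ : ℝ) : ℂ)) (by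
      refine hsq.congr fun n => ?_
      dsimp only
      rw [Finset.sum_const, Finset.card_univ, ZMod.card, nsmul_eq_mul, Complex.norm_real,
        Real.norm_of_nonneg (by positivity), hN]
      field_simp)
  have hfv : ∀ n x, ‖⟪f ⟨n, x⟩, v⟫_ℂ‖ = (((n : ℝ) + 1) ^ 3)⁻¹ := fun n x => by
    rw [hf, blockFamily, sum_inner, Finset.sum_eq_single_of_mem 0 (Finset.mem_univ _)]
    · rw [inner_smul_left, hv, if_pos rfl, norm_mul, RCLike.norm_conj, hUn, hsqrt,
        Complex.norm_real, Real.norm_of_nonneg (by positivity), ← mul_inv, ← pow_succ]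
    · intro y _ hy
      rw [inner_smul_left, hv, if_neg hy, mul_zero]
  have ht : ∀ p, ∑' q, (‖⟪b p, f q⟫_ℂ * ⟪f q, v⟫_ℂ‖ : ℂ) = (((p.1 : ℝ) + 1)⁻¹ : ℝ) := by
    rintro ⟨n, y⟩
    have hsupp : Function.support (fun q => (‖⟪b ⟨n, y⟩, f q⟫_ℂ * ⟪f q, v⟫_ℂ‖ : ℂ)) ⊆
        Set.range (Sigma.mk n) := by
      rintro ⟨m, x⟩ hx
      rcases eq_or_ne n m with rfl | hnm
      · exact ⟨x, rfl⟩
      · refine absurd ?_ hx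
        beta_reduce
        rw [hf, inner_blockFamily_of_ne b (p := ⟨n, y⟩) (q := ⟨m, x⟩) hnm]
        simp
    have hterm : ∀ x, (‖⟪b ⟨n, y⟩, f ⟨n, x⟩⟫_ℂ * ⟪f ⟨n, x⟩, v⟫_ℂ‖ : ℂ) =
        ((((n : ℝ) + 1) ^ 5)⁻¹ : ℝ) := fun x => by
      rw [norm_mul, hfv, hf, inner_blockFamily, hUn, hsqrt, ← mul_inv, ← pow_add]
    rw [← sigma_mk_injective.tsum_eq hsupp, tsum_fintype, Finset.sum_congr rfl fun x _ => hterm x,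
      Finset.sum_const, Finset.card_univ, ZMod.card, nsmul_eq_mul, ← Complex.ofReal_natCast (N n), hN,
      ← Complex.ofReal_mul]
    congr 1
    field_simp
  refine SpectralMeasure.exists_tripleOperatorIntegral_not_isTraceClass b f e (v := v) (w := w)
    (d := fun p => (N p.1 : ℝ)⁻¹) (fun p => by positivity) (C := 1) (fun p => ?_) (fun h => ?_)
    fun p => ?_
  · exact inv_le_one_of_one_le₀ (by exact_mod_cast NeZero.one_le)
  · have h1 := h.sigma
    have h2 : ∀ n, ∑' _ : ZMod (N n), (N n : ℝ)⁻¹ = 1 := fun n => by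
      rw [tsum_fintype, Finset.sum_const, Finset.card_univ, ZMod.card, nsmul_eq_mul]
      exact mul_inv_cancel₀ (Nat.cast_ne_zero.2 (NeZero.ne _))
    simp only [h2] at h1
    exact one_ne_zero ((summable_const_iff _).1 h1)
  · rw [ht, ← inner_conj_symm, hw, Complex.conj_ofReal, hN, ← Complex.ofReal_mul, ← mul_inv,
      ← pow_succ]
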